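/- For $d\ge 1$, $y\in\mathbb{R}^d$ and $l\in\{0,1,\dots,d\}$ let $\|y\|_{(l)}=\max_{K\subset\{1,\dots,d\},\,|K|\le l}\big(\sum_{i\in K}y_i^2\big)^{1/2}$ be the $2$-$l$-symmetric gauge norm (so $\|\cdot\|_{(0)}=0$), and let $\mathcal{L}_0:\mathbb{R}^d\to[-\infty,+\infty]$ be the Fenchel conjugate of $y\mapsto\max_{l=0,1,\dots,d}\big(\|y\|_{(l)}-l\big)$, that is, $$\mathcal{L}_0(x)=\sup_{y\in\mathbb{R}^d}\Big(\langle x,y\rangle-\max_{l=0,1,\dots,d}\big(\|y\|_{(l)}-l\big)\Big).$$ In dimension $d=2$, the function $\mathcal{L}_0$ is given by $$\mathcal{L}_0(x_1,x_2)=\begin{cases}+\infty & \text{if } x_1^2+x_2^2>1,\\ 1 & \text{if } (x_1,x_2)\in\{(1,0),(0,1),(-1,0),(0,-1)\},\\ 2 & \text{if } x_1^2+x_2^2=1 \text{ and } (x_1,x_2)\notin\{(1,0),(0,1),(-1,0),(0,-1)\},\end{cases}$$ and, for any $(x_1,x_2)$ such that $x_1^2+x_2^2<1$, by $$\mathcal{L}_0(x_1,x_2)=\begin{cases}|x_1|+|x_2|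 & \text{if } |x_1|+|x_2|\le 1,\\[1mm] \dfrac{|x_1|+|x_2|-2+\sqrt2}{\sqrt2-1} & \text{if } (\sqrt2-1)|x_1|+|x_2|<1,\ |x_1|+(\sqrt2-1)|x_2|<1 \text{ and } |x_1|+|x_2|>1,\\[2mm] \dfrac{3-|x_2|}{2}+\dfrac{x_1^2}{2(1-|x_2|)} & \text{if } (\sqrt2-1)|x_1|+|x_2|\ge 1 \text{ and } |x_2|>|x_1|,\\[2mm] \dfrac{3-|x_1|}{2}+\dfrac{x_2^2}{2(1-|x_1|)} & \text{if } |x_1|+(\sqrt2-1)|x_2|\ge 1 \text{ and } |x_1|>|x_2|.\end{cases}$$ -/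

import Mathlib

/-- The vector `x_K` that coincides with `x` on the components in `K` and vanishes on the
components outside of `K`. -/
noncomputable def restrictTo {d : ℕ} (K : Finset (Fin d)) (x : EuclideanSpace ℝ (Fin d)) :
    EuclideanSpace ℝ (Fin d) :=
  WithLp.toLp 2 (fun i => if i ∈ K then x i else 0)

/-- The `2`-`k`-symmetric gauge norm (Ky Fan vector norm): the supremum of the Euclidean norms
`‖x_K‖` over all sets `K` of at most `k` indices. It vanishes for `k = 0`. -/
noncomputable def symmetricGaugeNorm {d : ℕ} (k : ℕ) (x : EuclideanSpace ℝ (Fin d)) : ℝ :=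
  ⨆ K : {K : Finset (Fin d) // K.card ≤ k}, ‖restrictTo K.1 x‖

/-- The Fenchel conjugate `x ↦ sup_y (⟨x, y⟩ + (- g y))` of an extended real valued function.
The addition of `EReal` is the lower addition: `⊤ + ⊥ = ⊥ + ⊤ = ⊥`. -/
noncomputable def fenchelConjugate {d : ℕ} (g : EuclideanSpace ℝ (Fin d) → EReal)
    (x : EuclideanSpace ℝ (Fin d)) : EReal :=
  ⨆ y : EuclideanSpace ℝ (Fin d), ((inner ℝ x y : ℝ) : EReal) + (- g y)

/-- The function `𝓛₀` on `ℝ^d`: the Fenchel conjugate of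
`y ↦ sup_{l = 0, 1, …, d} (symmetricGaugeNorm l y - l)`. -/
noncomputable def calL0 (d : ℕ) : EuclideanSpace ℝ (Fin d) → EReal :=
  fenchelConjugate fun y =>
    ⨆ l : Fin (d + 1), ((symmetricGaugeNorm (l : ℕ) y - ((l : ℕ) : ℝ) : ℝ) : EReal)

/-! By duality, `calL0 2` is the closed convex hull of the function equal to 0 at the origin, 1 at
`±e₁, ±e₂` and 2 elsewhere on the unit circle. So each finite value comes from a convex combination:
weighting the affine bounds `0`, `u - 1`, `v - 1` and `⟨w, (u, v)⟩ - 2`, `w` a unit vector, all at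
most `gaugeMax u v`, gives the upper bound, and a point where the pieces in use agree and are
maximal gives equality (`calL0_two_eq_coe`). Signs are removed by evenness. The pieces are the
diamond, the triangle on `e₁`, `e₂`, `(√2/2, √2/2)`, and the caps, ruled by chords issued from `e₁`
or `e₂`. -/

/-! ### The gauge norms in dimension two -/

theorem norm_restrictTo_two (K : Finset (Fin 2)) (y : EuclideanSpace ℝ (Fin 2)) :
    ‖restrictTo K y‖ =
      √((if 0 ∈ K then y 0 ^ 2 else 0) + (if 1 ∈ K then y 1 ^ 2 else 0)) := by
  rw [EuclideanSpace.norm_eq, Fin.sum_univ_two]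
  congr 1
  simp only [restrictTo, Real.norm_eq_abs, sq_abs]
  split_ifs <;> simp

theorem norm_restrictTo_le_symmetricGaugeNorm {d k : ℕ} {K : Finset (Fin d)} (hK : K.card ≤ k)
    (y : EuclideanSpace ℝ (Fin d)) : ‖restrictTo K y‖ ≤ symmetricGaugeNorm k y :=
  le_ciSup (f := fun K : {K : Finset (Fin d) // K.card ≤ k} => ‖restrictTo K.1 y‖)
    (Set.finite_range _).bddAbove ⟨K, hK⟩

theorem symmetricGaugeNorm_le {d k : ℕ} {y : EuclideanSpace ℝ (Fin d)} {c : ℝ}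
    (h : ∀ K : Finset (Fin d), K.card ≤ k → ‖restrictTo K y‖ ≤ c) :
    symmetricGaugeNorm k y ≤ c :=
  haveI : Nonempty {K : Finset (Fin d) // K.card ≤ k} := ⟨⟨∅, by simp⟩⟩
  ciSup_le fun K => h K.1 K.2

theorem symmetricGaugeNorm_zero (y : EuclideanSpace ℝ (Fin 2)) :
    symmetricGaugeNorm 0 y = 0 := by
  apply le_antisymm
  · refine symmetricGaugeNorm_le fun K hK => ?_
    obtain rfl : K = ∅ := by simpa using hK
    simp [norm_restrictTo_two]
  · exact (norm_nonneg _).trans (norm_restrictTo_le_symmetricGaugeNorm (K := ∅) (by simp) y)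

theorem symmetricGaugeNorm_one (y : EuclideanSpace ℝ (Fin 2)) :
    symmetricGaugeNorm 1 y = max |y 0| |y 1| := by
  apply le_antisymm
  · refine symmetricGaugeNorm_le fun K hK => ?_
    rw [norm_restrictTo_two]
    by_cases h0 : (0 : Fin 2) ∈ K <;> by_cases h1 : (1 : Fin 2) ∈ K
    · exact absurd (Finset.card_le_one.mp hK 0 h0 1 h1) (by decide)
    · simp [h0, h1, Real.sqrt_sq_eq_abs]
    · simp [h0, h1, Real.sqrt_sq_eq_abs]
    · simp [h0, h1]
  · apply max_le
    · simpa [norm_restrictTo_two, Real.sqrt_sq_eq_abs] using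
        norm_restrictTo_le_symmetricGaugeNorm (K := {0}) (k := 1) (by simp) y
    · simpa [norm_restrictTo_two, Real.sqrt_sq_eq_abs] using
        norm_restrictTo_le_symmetricGaugeNorm (K := {1}) (k := 1) (by simp) y

theorem symmetricGaugeNorm_two (y : EuclideanSpace ℝ (Fin 2)) :
    symmetricGaugeNorm 2 y = √(y 0 ^ 2 + y 1 ^ 2) := by
  apply le_antisymm
  · refine symmetricGaugeNorm_le fun K _ => ?_
    rw [norm_restrictTo_two]
    apply Real.sqrt_le_sqrt
    have h0 := sq_nonneg (y 0)
    have h1 := sq_nonneg (y 1)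
    split_ifs <;> linarith
  · simpa [norm_restrictTo_two] using
      norm_restrictTo_le_symmetricGaugeNorm (K := Finset.univ) (k := 2) (by simp) y

/-- In dimension two, the maximum over `l` of `symmetricGaugeNorm l y - l`, as a function of
the absolute values of the two coordinates of `y`. -/
noncomputable def gaugeMax (u v : ℝ) : ℝ :=
  max (max 0 (max u v - 1)) (√(u ^ 2 + v ^ 2) - 2)

theorem gaugeMax_comm (u v : ℝ) : gaugeMax u v = gaugeMax v u := by
  rw [gaugeMax, gaugeMax, max_comm u v, add_comm (u ^ 2)]

theorem gaugeMax_nonneg (u v : ℝ) : 0 ≤ gaugeMax u v :=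
  (le_max_left _ _).trans (le_max_left _ _)

theorem sub_one_le_gaugeMax (u v : ℝ) : max u v - 1 ≤ gaugeMax u v :=
  (le_max_right _ _).trans (le_max_left _ _)

theorem sqrt_sub_two_le_gaugeMax (u v : ℝ) : √(u ^ 2 + v ^ 2) - 2 ≤ gaugeMax u v :=
  le_max_right _ _

theorem iSup_symmetricGaugeNorm_sub (y : EuclideanSpace ℝ (Fin 2)) :
    (⨆ l : Fin (2 + 1), ((symmetricGaugeNorm (l : ℕ) y - ((l : ℕ) : ℝ) : ℝ) : EReal)) =
      (gaugeMax |y 0| |y 1| : ℝ) := by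
  have h0 := symmetricGaugeNorm_zero y
  have h1 := symmetricGaugeNorm_one y
  have h2 := symmetricGaugeNorm_two y
  apply le_antisymm
  · refine iSup_le fun l => EReal.coe_le_coe_iff.mpr ?_
    fin_cases l
    · simpa [h0] using gaugeMax_nonneg |y 0| |y 1|
    · simpa [h1] using sub_one_le_gaugeMax |y 0| |y 1|
    · simpa [h2] using sqrt_sub_two_le_gaugeMax |y 0| |y 1|
  · have key : ∀ l : Fin (2 + 1), ((symmetricGaugeNorm (l : ℕ) y - ((l : ℕ) : ℝ) : ℝ) : EReal) ≤
        ⨆ l : Fin (2 + 1), ((symmetricGaugeNorm (l : ℕ) y - ((l : ℕ) : ℝ) : ℝ) : EReal) :=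
      fun l => le_iSup (fun l : Fin (2 + 1) =>
        ((symmetricGaugeNorm (l : ℕ) y - ((l : ℕ) : ℝ) : ℝ) : EReal)) l
    unfold gaugeMax
    rcases max_choice (max 0 (max |y 0| |y 1| - 1)) (√(|y 0| ^ 2 + |y 1| ^ 2) - 2) with h | h
    · rw [h]
      rcases max_choice 0 (max |y 0| |y 1| - 1) with h | h
      · rw [h]
        refine le_trans (le_of_eq ?_) (key 0)
        simp [h0]
      · rw [h]
        refine le_trans (le_of_eq ?_) (key 1)
        simp [h1]
    · rw [h]
      refine le_trans (le_of_eq ?_) (key 2)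
      simp [h2]

/-! ### Reduction to the nonnegative quadrant -/

theorem calL0_two_eq (x₁ x₂ : ℝ) :
    calL0 2 !₂[x₁, x₂] = ⨆ y : EuclideanSpace ℝ (Fin 2),
      ((x₁ * y 0 + x₂ * y 1 - gaugeMax |y 0| |y 1| : ℝ) : EReal) := by
  unfold calL0 fenchelConjugate
  refine iSup_congr fun y => ?_
  beta_reduce
  rw [iSup_symmetricGaugeNorm_sub, ← EReal.coe_neg, ← EReal.coe_add, ← sub_eq_add_neg]
  congr 2
  simp [PiLp.inner_apply, Fin.sum_univ_two, mul_comm]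

theorem calL0_two_le {x₁ x₂ c : ℝ}
    (h : ∀ u v : ℝ, 0 ≤ u → 0 ≤ v → |x₁| * u + |x₂| * v ≤ c + gaugeMax u v) :
    calL0 2 !₂[x₁, x₂] ≤ (c : EReal) := by
  rw [calL0_two_eq]
  refine iSup_le fun y => EReal.coe_le_coe_iff.mpr ?_
  have h1 := h |y 0| |y 1| (abs_nonneg _) (abs_nonneg _)
  rw [← abs_mul, ← abs_mul] at h1
  linarith [le_abs_self (x₁ * y 0), le_abs_self (x₂ * y 1)]

theorem exists_abs_eq_mul_eq (x : ℝ) {u : ℝ} (hu : 0 ≤ u) :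
    ∃ t : ℝ, |t| = u ∧ x * t = |x| * u := by
  rcases abs_cases x with ⟨h, _⟩ | ⟨h, _⟩
  · exact ⟨u, abs_of_nonneg hu, by rw [h]⟩
  · exact ⟨-u, by rw [abs_neg, abs_of_nonneg hu], by rw [h]; ring⟩

/-- Giving the coordinates of `y` the signs of those of `x` turns the inner product into `|x₁| * u +
|x₂| * v`. -/
theorem le_calL0_two (x₁ x₂ : ℝ) {u v : ℝ} (hu : 0 ≤ u) (hv : 0 ≤ v) :
    ((|x₁| * u + |x₂| * v - gaugeMax u v : ℝ) : EReal) ≤ calL0 2 !₂[x₁, x₂] := by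
  obtain ⟨s, hs, hs'⟩ := exists_abs_eq_mul_eq x₁ hu
  obtain ⟨t, ht, ht'⟩ := exists_abs_eq_mul_eq x₂ hv
  rw [calL0_two_eq, ← hs', ← ht', ← hs, ← ht]
  exact le_iSup (fun y : EuclideanSpace ℝ (Fin 2) =>
    ((x₁ * y 0 + x₂ * y 1 - gaugeMax |y 0| |y 1| : ℝ) : EReal)) !₂[s, t]

/-- Certificate for a value of `calL0 2`: an upper bound together with a point attaining it. -/
theorem calL0_two_eq_coe {x₁ x₂ c u v : ℝ}
    (h : ∀ u v : ℝ, 0 ≤ u → 0 ≤ v → |x₁| * u + |x₂| * v ≤ c + gaugeMax u v)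
    (hu : 0 ≤ u) (hv : 0 ≤ v) (hc : gaugeMax u v ≤ |x₁| * u + |x₂| * v - c) :
    calL0 2 !₂[x₁, x₂] = (c : EReal) :=
  le_antisymm (calL0_two_le h)
    ((EReal.coe_le_coe_iff.mpr (by linarith)).trans (le_calL0_two x₁ x₂ hu hv))

theorem calL0_two_swap (x₁ x₂ : ℝ) : calL0 2 !₂[x₁, x₂] = calL0 2 !₂[x₂, x₁] := by
  suffices H : ∀ a b : ℝ, calL0 2 !₂[a, b] ≤ calL0 2 !₂[b, a] from
    le_antisymm (H _ _) (H _ _)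
  intro a b
  rw [calL0_two_eq a b, calL0_two_eq b a]
  refine iSup_le fun y => ?_
  refine le_trans (le_of_eq ?_) (le_iSup (fun y : EuclideanSpace ℝ (Fin 2) =>
    ((b * y 0 + a * y 1 - gaugeMax |y 0| |y 1| : ℝ) : EReal)) !₂[y 1, y 0])
  simp [gaugeMax_comm |y 1|, add_comm]

theorem mul_add_mul_le_sqrt_mul_sqrt (a b u v : ℝ) :
    a * u + b * v ≤ √(a ^ 2 + b ^ 2) * √(u ^ 2 + v ^ 2) := by
  rw [← Real.sqrt_mul (by positivity)]
  exact Real.le_sqrt_of_sq_le (by nlinarith [sq_nonneg (a * v - b * u)])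

/-! ### Values region by region -/

theorem calL0_two_eq_top {x₁ x₂ : ℝ} (h : 1 < x₁ ^ 2 + x₂ ^ 2) :
    calL0 2 !₂[x₁, x₂] = ⊤ := by
  rw [EReal.eq_top_iff_forall_lt]
  intro c
  set n := √(x₁ ^ 2 + x₂ ^ 2) with hn
  have hn2 : n ^ 2 = x₁ ^ 2 + x₂ ^ 2 := Real.sq_sqrt (by positivity)
  have hn0 : 0 ≤ n := Real.sqrt_nonneg _
  have hn1 : 1 < n := by nlinarith
  have hpos : 0 < n * (n - 1) := mul_pos (by linarith) (by linarith)
  -- Along the ray of `x` the objective is at least `t * n ^ 2 - t * n`; this `t` makes that `|c| +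
  -- 1`.
  set t := (|c| + 1) / (n * (n - 1)) with ht
  have ht0 : 0 ≤ t := by positivity
  have htn : t * (n * (n - 1)) = |c| + 1 := div_mul_cancel₀ _ hpos.ne'
  have ha : |x₁| ≤ n := Real.abs_le_sqrt (by nlinarith [sq_nonneg x₂])
  have hb : |x₂| ≤ n := Real.abs_le_sqrt (by nlinarith [sq_nonneg x₁])
  have hnorm : √((t * |x₁|) ^ 2 + (t * |x₂|) ^ 2) = t * n := by
    rw [mul_pow, mul_pow, sq_abs, sq_abs, ← mul_add, ← hn2, ← mul_pow,
      Real.sqrt_sq (by positivity)]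
  have hg : gaugeMax (t * |x₁|) (t * |x₂|) ≤ t * n := by
    unfold gaugeMax
    rw [hnorm]
    have h1 := mul_le_mul_of_nonneg_left ha ht0
    have h2 := mul_le_mul_of_nonneg_left hb ht0
    have h3 : max (t * |x₁|) (t * |x₂|) ≤ t * n := max_le h1 h2
    exact max_le (max_le (by positivity) (by linarith)) (by linarith)
  refine lt_of_lt_of_le (EReal.coe_lt_coe_iff.mpr ?_)
    (le_calL0_two x₁ x₂ (u := t * |x₁|) (v := t * |x₂|) (by positivity) (by positivity))
  have e : |x₁| * (t * |x₁|) + |x₂| * (t * |x₂|) = t * n ^ 2 := by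
    rw [hn2, ← sq_abs x₁, ← sq_abs x₂]; ring
  rw [e]
  nlinarith [le_abs_self c]

theorem calL0_two_of_abs_eq_one_zero {x₁ x₂ : ℝ} (h₁ : |x₁| = 1) (h₂ : x₂ = 0) :
    calL0 2 !₂[x₁, x₂] = 1 := by
  refine calL0_two_eq_coe (c := 1) (u := 1) (v := 0) (fun u v _ _ => ?_) zero_le_one le_rfl ?_
  · rw [h₁, h₂, abs_zero]
    linarith [sub_one_le_gaugeMax u v, le_max_left u v]
  · simp [gaugeMax, h₁, h₂]

theorem calL0_two_of_sq_add_sq_eq_one {x₁ x₂ : ℝ} (h : x₁ ^ 2 + x₂ ^ 2 = 1) (h₁ : x₁ ≠ 0)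
    (h₂ : x₂ ≠ 0) : calL0 2 !₂[x₁, x₂] = 2 := by
  have ha : 0 < |x₁| := abs_pos.mpr h₁
  have hb : 0 < |x₂| := abs_pos.mpr h₂
  rw [← sq_abs x₁, ← sq_abs x₂] at h
  set a := |x₁|
  set b := |x₂|
  have ha1 : a < 1 := by nlinarith
  have hb1 : b < 1 := by nlinarith
  -- The maximizer is sought on the ray of `x`, at norm `p + q`: large enough that the norm minus 2
  -- dominates both coordinates minus 1.
  have hpa : 0 < 1 / (1 - a) := one_div_pos.mpr (by linarith)
  have hpb : 0 < 1 / (1 - b) := one_div_pos.mpr (by linarith)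
  have ea : 1 / (1 - a) * (1 - a) = 1 := one_div_mul_cancel (by linarith)
  have eb : 1 / (1 - b) * (1 - b) = 1 := one_div_mul_cancel (by linarith)
  set p := 1 / (1 - a)
  set q := 1 / (1 - b)
  have hp1 : 1 < p := by nlinarith
  have hq1 : 1 < q := by nlinarith
  refine calL0_two_eq_coe (c := 2) (u := (p + q) * a) (v := (p + q) * b) (fun u v _ _ => ?_)
    (by positivity) (by positivity) ?_
  · have := mul_add_mul_le_sqrt_mul_sqrt a b u v
    rw [h, Real.sqrt_one, one_mul] at this
    linarith [sqrt_sub_two_le_gaugeMax u v]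
  · have e : a * ((p + q) * a) + b * ((p + q) * b) = p + q := by linear_combination (p + q) * h
    have e' : √(((p + q) * a) ^ 2 + ((p + q) * b) ^ 2) = p + q := by
      rw [mul_pow, mul_pow, ← mul_add, h, mul_one, Real.sqrt_sq (by positivity)]
    have h3 : max ((p + q) * a) ((p + q) * b) ≤ p + q - 1 := max_le (by nlinarith) (by nlinarith)
    rw [gaugeMax, e, e']
    exact max_le (max_le (by linarith) (by linarith)) le_rfl

theorem calL0_two_of_abs_add_abs_le_one {x₁ x₂ : ℝ} (h : |x₁| + |x₂| ≤ 1) :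
    calL0 2 !₂[x₁, x₂] = ((|x₁| + |x₂| : ℝ) : EReal) := by
  have ha := abs_nonneg x₁
  have hb := abs_nonneg x₂
  -- At `(1, 1)` the pieces `0`, `u - 1` and `v - 1` all vanish.
  refine calL0_two_eq_coe (u := 1) (v := 1) (fun u v _ _ => ?_) zero_le_one zero_le_one ?_
  · have h1 := mul_le_mul_of_nonneg_left (le_max_left u v) ha
    have h2 := mul_le_mul_of_nonneg_left (le_max_right u v) hb
    have h3 := sub_one_le_gaugeMax u v
    have h4 := gaugeMax_nonneg u v
    rcases le_total (max u v) 1 with hm | hm <;> nlinarith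
  · simp only [gaugeMax, max_self, one_pow]
    norm_num

theorem calL0_two_of_mem_triangle {x₁ x₂ : ℝ} (h₁ : (√2 - 1) * |x₁| + |x₂| < 1)
    (h₂ : |x₁| + (√2 - 1) * |x₂| < 1) (h : 1 < |x₁| + |x₂|) :
    calL0 2 !₂[x₁, x₂] = (((|x₁| + |x₂| - 2 + √2) / (√2 - 1) : ℝ) : EReal) := by
  have s2 : √(2 : ℝ) ^ 2 = 2 := Real.sq_sqrt (by norm_num)
  have s0 : 0 ≤ √(2 : ℝ) := Real.sqrt_nonneg _
  have s1 : 1.4 < √(2 : ℝ) := by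
    rw [Real.lt_sqrt (by norm_num)]; norm_num
  set s := √(2 : ℝ)
  set a := |x₁|
  set b := |x₂|
  have hc : (a + b - 2 + s) / (s - 1) = (a + b) * (s + 1) - s := by
    rw [div_eq_iff (by linarith)]
    linear_combination (1 - a - b) * s2
  rw [hc]
  -- Here the pieces `u - 1`, `v - 1` and norm minus 2 all equal `s`.
  refine calL0_two_eq_coe (u := s + 1) (v := s + 1) (fun u v _ _ => ?_) (by linarith)
    (by linarith) ?_
  · have hu : u - 1 ≤ gaugeMax u v := by
      linarith [sub_one_le_gaugeMax u v, le_max_left u v]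
    have hv : v - 1 ≤ gaugeMax u v := by
      linarith [sub_one_le_gaugeMax u v, le_max_right u v]
    have hw : s / 2 * (u + v) - 2 ≤ gaugeMax u v := by
      have := mul_add_mul_le_sqrt_mul_sqrt (s / 2) (s / 2) u v
      rw [show (s / 2) ^ 2 + (s / 2) ^ 2 = 1 by linear_combination s2 / 2, Real.sqrt_one] at this
      linarith [sqrt_sub_two_le_gaugeMax u v]
    -- barycentric coordinates of `(a, b)` in the triangle `(1, 0)`, `(0, 1)`, `(√2/2, √2/2)`
    obtain ⟨l, hl⟩ : ∃ l, l = (a + b - 1) * (s + 1) := ⟨_, rfl⟩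
    have w₁ : 0 ≤ a - s / 2 * l := by
      have : a - s / 2 * l = (1 - (s - 1) * a - b) * ((s + 2) / 2) := by
        rw [hl]; linear_combination (-b / 2 + 1 / 2) * s2
      rw [this]
      apply mul_nonneg <;> linarith
    have w₂ : 0 ≤ b - s / 2 * l := by
      have : b - s / 2 * l = (1 - a - (s - 1) * b) * ((s + 2) / 2) := by
        rw [hl]; linear_combination (-a / 2 + 1 / 2) * s2
      rw [this]
      apply mul_nonneg <;> linarith
    have w₃ : 0 ≤ l := by
      rw [hl]
      apply mul_nonneg <;> linarith
    have hsum : a + b - s * l + l = 1 := by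
      rw [hl]; linear_combination (1 - a - b) * s2
    have k₁ := mul_le_mul_of_nonneg_left hu w₁
    have k₂ := mul_le_mul_of_nonneg_left hv w₂
    have k₃ := mul_le_mul_of_nonneg_left hw w₃
    have k : (a + b - s * l + l) * gaugeMax u v = gaugeMax u v := by rw [hsum, one_mul]
    change a * u + b * v ≤ _
    linarith
  · have e : √((s + 1) ^ 2 + (s + 1) ^ 2) = s + 2 := by
      rw [show (s + 1) ^ 2 + (s + 1) ^ 2 = (s + 2) ^ 2 by linear_combination s2,
        Real.sqrt_sq (by linarith)]
    rw [gaugeMax, e, max_self]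
    exact max_le (max_le (by linarith) (by linarith)) (by linarith)

theorem calL0_two_of_cap {x₁ x₂ : ℝ} (hx : x₁ ^ 2 + x₂ ^ 2 < 1)
    (h₁ : 1 ≤ (√2 - 1) * |x₁| + |x₂|) :
    calL0 2 !₂[x₁, x₂] =
      (((3 - |x₂|) / 2 + x₁ ^ 2 / (2 * (1 - |x₂|)) : ℝ) : EReal) := by
  have s2 : √(2 : ℝ) ^ 2 = 2 := Real.sq_sqrt (by norm_num)
  have s0 : 0 ≤ √(2 : ℝ) := Real.sqrt_nonneg _
  have s1 : 1.4 < √(2 : ℝ) := by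
    rw [Real.lt_sqrt (by norm_num)]; norm_num
  have ha := abs_nonneg x₁
  have hb := abs_nonneg x₂
  rw [← sq_abs x₁] at hx ⊢
  rw [← sq_abs x₂] at hx
  set s := √(2 : ℝ)
  set a := |x₁|
  set b := |x₂|
  have hb1 : 0 < 1 - b := by nlinarith
  -- `r` parametrizes the line through `(0, 1)` and `(a, b)`, as in stereographic projection from
  -- `(0, 1)`.
  obtain ⟨r, hr⟩ : ∃ r, a = r * (1 - b) := ⟨a / (1 - b), by field_simp⟩
  have hrs : s + 1 ≤ r := by
    have : 1 ≤ (s - 1) * r := by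
      refine le_of_mul_le_mul_right ?_ hb1
      rw [mul_assoc, ← hr]; linarith
    nlinarith
  have hc : (3 - b) / 2 + a ^ 2 / (2 * (1 - b)) = 1 + (r ^ 2 + 1) / 2 * (1 - b) := by
    rw [hr]; field_simp; ring
  rw [hc]
  -- weight of the unit vector `(2 r, r ^ 2 - 1) / (r ^ 2 + 1)` in the convex combination
  -- of it with `(0, 1)` that represents `(a, b)`
  set m := (r ^ 2 + 1) / 2 * (1 - b) with hm
  have hm1 : m ≤ 1 := by
    rw [hr] at hx
    have : (r ^ 2 + 1) * (1 - b) < 2 := by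
      refine lt_of_mul_lt_mul_right ?_ hb1.le
      nlinarith
    linarith
  -- A multiple of that unit vector, scaled so that `v - 1` equals the norm minus 2. The bound `s +
  -- 1 ≤ r` says exactly that `u ≤ v` there.
  refine calL0_two_eq_coe (u := r) (v := (r ^ 2 - 1) / 2) (fun u v _ _ => ?_) (by linarith)
    (by nlinarith) ?_
  · have hv : v - 1 ≤ gaugeMax u v := by
      linarith [sub_one_le_gaugeMax u v, le_max_right u v]
    have hw : r * u + (r ^ 2 - 1) / 2 * v ≤ (r ^ 2 + 1) / 2 * (gaugeMax u v + 2) := by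
      have := mul_add_mul_le_sqrt_mul_sqrt r ((r ^ 2 - 1) / 2) u v
      rw [show r ^ 2 + ((r ^ 2 - 1) / 2) ^ 2 = ((r ^ 2 + 1) / 2) ^ 2 by ring,
        Real.sqrt_sq (by positivity)] at this
      exact this.trans (mul_le_mul_of_nonneg_left
        (by linarith [sqrt_sub_two_le_gaugeMax u v]) (by positivity))
    have k₁ := mul_le_mul_of_nonneg_left hv (sub_nonneg.mpr hm1)
    have k₂ := mul_le_mul_of_nonneg_left hw hb1.le
    change a * u + b * v ≤ _
    rw [hr]
    rw [hm] at k₁ ⊢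
    linarith
  · have e : √(r ^ 2 + ((r ^ 2 - 1) / 2) ^ 2) = (r ^ 2 + 1) / 2 := by
      rw [show r ^ 2 + ((r ^ 2 - 1) / 2) ^ 2 = ((r ^ 2 + 1) / 2) ^ 2 by ring,
        Real.sqrt_sq (by positivity)]
    have e' : a * r + b * ((r ^ 2 - 1) / 2) - (1 + m) = (r ^ 2 + 1) / 2 - 2 := by
      rw [hm, hr]; ring
    have hmax : max r ((r ^ 2 - 1) / 2) = (r ^ 2 - 1) / 2 := max_eq_right (by nlinarith)
    rw [gaugeMax, e, e', hmax]
    exact max_le (max_le (by nlinarith) (by linarith)) le_rfl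

theorem mainTheorem4 (x₁ x₂ : ℝ) :
    (1 < x₁ ^ 2 + x₂ ^ 2 → calL0 2 !₂[x₁, x₂] = ⊤) ∧
    ((x₁, x₂) ∈ ({(1, 0), (0, 1), (-1, 0), (0, -1)} : Set (ℝ × ℝ)) →
      calL0 2 !₂[x₁, x₂] = 1) ∧
    (x₁ ^ 2 + x₂ ^ 2 = 1 →
      (x₁, x₂) ∉ ({(1, 0), (0, 1), (-1, 0), (0, -1)} : Set (ℝ × ℝ)) →
      calL0 2 !₂[x₁, x₂] = 2) ∧
    (x₁ ^ 2 + x₂ ^ 2 < 1 →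
      (|x₁| + |x₂| ≤ 1 →
        calL0 2 !₂[x₁, x₂] = ((|x₁| + |x₂| : ℝ) : EReal)) ∧
      ((√2 - 1) * |x₁| + |x₂| < 1 → |x₁| + (√2 - 1) * |x₂| < 1 → 1 < |x₁| + |x₂| →
        calL0 2 !₂[x₁, x₂] = (((|x₁| + |x₂| - 2 + √2) / (√2 - 1) : ℝ) : EReal)) ∧
      (1 ≤ (√2 - 1) * |x₁| + |x₂| → |x₁| < |x₂| →
        calL0 2 !₂[x₁, x₂] = (((3 - |x₂|) / 2 + x₁ ^ 2 / (2 * (1 - |x₂|)) : ℝ) : EReal)) ∧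
      (1 ≤ |x₁| + (√2 - 1) * |x₂| → |x₂| < |x₁| →
        calL0 2 !₂[x₁, x₂] = (((3 - |x₁|) / 2 + x₂ ^ 2 / (2 * (1 - |x₁|)) : ℝ) : EReal))) := by
  refine ⟨calL0_two_eq_top, fun h => ?_, fun h hne => ?_, fun hx =>
    ⟨calL0_two_of_abs_add_abs_le_one, calL0_two_of_mem_triangle,
      fun h _ => calL0_two_of_cap hx h, fun h _ => ?_⟩⟩
  · simp only [Set.mem_insert_iff, Set.mem_singleton_iff, Prod.mk.injEq] at h
    rcases h with ⟨rfl, rfl⟩ | ⟨rfl, rfl⟩ | ⟨rfl, rfl⟩ | ⟨rfl, rfl⟩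
    · exact calL0_two_of_abs_eq_one_zero (by simp) rfl
    · rw [calL0_two_swap]
      exact calL0_two_of_abs_eq_one_zero (by simp) rfl
    · exact calL0_two_of_abs_eq_one_zero (by simp) rfl
    · rw [calL0_two_swap]
      exact calL0_two_of_abs_eq_one_zero (by simp) rfl
  · simp only [Set.mem_insert_iff, Set.mem_singleton_iff, Prod.mk.injEq] at hne
    refine calL0_two_of_sq_add_sq_eq_one h (fun h0 => hne ?_) (fun h0 => hne ?_)
    · subst h0
      have : x₂ = 1 ∨ x₂ = -1 := eq_or_eq_neg_of_sq_eq_sq _ _ (by linarith)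
      tauto
    · subst h0
      have : x₁ = 1 ∨ x₁ = -1 := eq_or_eq_neg_of_sq_eq_sq _ _ (by linarith)
      tauto
  · rw [calL0_two_swap]
    exact calL0_two_of_cap (by linarith) (by linarith)
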